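/- Let $R$ be an associative ring with identity, and let all modules be $R$-modules on a fixed side. An inverse system of sets $(H_i, h_{ij}\colon H_j\to H_i \mid i\le j\in I)$ over a directed index set satisfies the Mittag-Leffler condition if for every $i\in I$ there is $j\ge i$ with $\operatorname{Im}(h_{ij})=\operatorname{Im}(h_{ik})$ for all $k\ge j$. It satisfies the strict Mittag-Leffler condition if moreover $j$ can be chosen so that this common image is the image of the limit map $\varprojlim_{k} H_k\to H_i$. Given a module $B$, a module $M$ is called (strict) $B$-stationary if $M$ is the direct limit of some directed system $(F_i, f_{ji}\mid i\le j\in I)$ of finitely presented modules for which the inverse system $(\operatorname{Hom}_R(F_i,B), \operatorname{Hom}_R(f_{ji},B))$, with limit $\operatorname{Hom}_R(M,B)$, satisfies the (strict) Mittag-Leffler condition. A module is pure-injective if it is injective with respect to all pure monomorphisms, and $B$ is $\Sigma$-pure-injective if the direct sum $B^{(I)}$ is pure-injective for every set $I$. A module $M$ is countably presented if there is an exact sequence $R^{(\mathbb N)}\to R^{(\mathbb N)}\to M\to 0$. Lemma. For every module $B$ the following are equivalent: 1. $B$ is $\Sigma$-pure-injective. 2. All modules are strict $B$-stationary. 3.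 All modules are $B$-stationary. 4. All countably presented modules are $B$-stationary. -/

import Mathlib

universe u w

/-- A linear map `f : A → C` of `R`-modules is a pure monomorphism: it is injective, and every
finite system of linear equations with constants in `A` that is solvable in `C` is solvable in
`A`. -/
def IsPureMono {R A C : Type*} [Ring R] [AddCommGroup A] [Module R A] [AddCommGroup C] [Module R C]
    (f : A →ₗ[R] C) : Prop :=
  Function.Injective f ∧
    ∀ (m n : ℕ) (r : Fin m → Fin n → R) (a : Fin m → A),
      (∃ c : Fin n → C, ∀ i, ∑ j, r i j • c j = f (a i)) →
        ∃ x : Fin n → A, ∀ i, ∑ j, r i j • x j = a i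

/-- `B` is pure-injective: every homomorphism to `B` extends along every pure monomorphism. -/
def IsPureInjective (R : Type u) [Ring R] (B : Type w) [AddCommGroup B] [Module R B] : Prop :=
  ∀ (A C : Type w) [AddCommGroup A] [Module R A] [AddCommGroup C] [Module R C] (f : A →ₗ[R] C),
    IsPureMono f → ∀ g : A →ₗ[R] B, ∃ h : C →ₗ[R] B, h ∘ₗ f = g

/-- `B` is `Σ`-pure-injective: every direct sum of copies of `B` is pure-injective. -/
def IsSigmaPureInjective (R : Type u) [Ring R] (B : Type w) [AddCommGroup B] [Module R B] : Prop :=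
  ∀ I : Type w, IsPureInjective R (I →₀ B)

/-- `M` is countably presented: there is an exact sequence `R^(ℕ) → R^(ℕ) → M → 0`.  (Finitely
generated and finitely presented modules are not excluded: one may repeat generators and
relations.) -/
def IsCountablyPresented (R : Type u) [Ring R] (M : Type w) [AddCommGroup M] [Module R M] : Prop :=
  ∃ (g : (ℕ →₀ R) →ₗ[R] (ℕ →₀ R)) (q : (ℕ →₀ R) →ₗ[R] M),
    Function.Exact g q ∧ Function.Surjective q

/-- The Mittag-Leffler condition for an inverse system `(H i, h : H j → H i)` : for each `i`, the
images of `h : H k → H i` are constant from some `j ≥ i` on. -/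
def IsMittagLeffler {I : Type*} [Preorder I] {H : I → Type*}
    (h : ∀ ⦃i j : I⦄, i ≤ j → H j → H i) : Prop :=
  ∀ i, ∃ (j : I) (hij : i ≤ j), ∀ (k : I) (hjk : j ≤ k),
    Set.range (h hij) = Set.range (h (hij.trans hjk))

/-- The strict Mittag-Leffler condition for an inverse system with inverse limit `L` and limit maps
`p i : L → H i` : moreover, the stable image is the image of the limit map. -/
def IsStrictMittagLeffler {I : Type*} [Preorder I] {H : I → Type*}
    (h : ∀ ⦃i j : I⦄, i ≤ j → H j → H i) {L : Type*} (p : ∀ i, L → H i) : Prop :=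
  ∀ i, ∃ (j : I) (hij : i ≤ j),
    (∀ (k : I) (hjk : j ≤ k), Set.range (h hij) = Set.range (h (hij.trans hjk))) ∧
      Set.range (h hij) = Set.range (p i)

/-- A directed presentation of `M` by finitely presented modules: a directed system of finitely
presented modules, indexed by a nonempty directed set, together with maps to `M` that make `M` its
direct limit. -/
structure DirectedPresentation (R : Type u) [Ring R] (M : Type w) [AddCommGroup M]
    [Module R M] where
  /-- The index set. -/
  I : Type w
  [decidableEq : DecidableEq I]
  [preorder : Preorder I]
  [nonempty : Nonempty I]
  [directed : IsDirectedOrder I]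
  /-- The modules of the system. -/
  F : I → Type w
  [addCommGroup : ∀ i, AddCommGroup (F i)]
  [module : ∀ i, Module R (F i)]
  [finitePresentation : ∀ i, Module.FinitePresentation R (F i)]
  /-- The transition maps. -/
  f : ∀ i j, i ≤ j → F i →ₗ[R] F j
  [directedSystem : DirectedSystem F (fun i j hij => f i j hij)]
  /-- The canonical maps to the direct limit. -/
  toLimit : ∀ i, F i →ₗ[R] M
  compatible : ∀ i j hij x, toLimit j (f i j hij x) = toLimit i x
  isLimit : Function.Bijective (Module.DirectLimit.lift R I F f toLimit compatible)

namespace DirectedPresentation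

attribute [instance] decidableEq preorder nonempty directed addCommGroup module finitePresentation
  directedSystem

variable {R : Type u} [Ring R] {M : Type w} [AddCommGroup M] [Module R M]

/-- The transition maps of the inverse system `Hom(F i, B)`. -/
def homMap (P : DirectedPresentation R M) (B : Type*) [AddCommGroup B] [Module R B]
    ⦃i j : P.I⦄ (hij : i ≤ j) (g : P.F j →ₗ[R] B) : P.F i →ₗ[R] B :=
  g ∘ₗ P.f i j hij

/-- The limit maps `Hom(M, B) → Hom(F i, B)` of the inverse system `Hom(F i, B)`, whose inverse
limit is `Hom(M, B)`. -/
def homLimitMap (P : DirectedPresentation R M) (B : Type*) [AddCommGroup B] [Module R B]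
    (i : P.I) (g : M →ₗ[R] B) : P.F i →ₗ[R] B :=
  g ∘ₗ P.toLimit i

end DirectedPresentation

/-- `M` is `B`-stationary: it has a directed presentation by finitely presented modules whose image
under `Hom(-, B)` is a Mittag-Leffler inverse system. -/
def IsStationaryModule (R : Type u) [Ring R] (B : Type*) [AddCommGroup B] [Module R B]
    (M : Type w) [AddCommGroup M] [Module R M] : Prop :=
  ∃ P : DirectedPresentation R M, IsMittagLeffler (P.homMap B)

/-- `M` is strict `B`-stationary: it has a directed presentation by finitely presented modules whose
image under `Hom(-, B)` is a strict Mittag-Leffler inverse system. -/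
def IsStrictStationaryModule (R : Type u) [Ring R] (B : Type*) [AddCommGroup B] [Module R B]
    (M : Type w) [AddCommGroup M] [Module R M] : Prop :=
  ∃ P : DirectedPresentation R M, IsStrictMittagLeffler (P.homMap B) (P.homLimitMap B)

/-! The cycle 1 → 2 → 3 → 4 → 1 is closed by the descending chain condition on pp-definable subsets
of `B`.

From 1 to 2, any directed presentation works. If the images of `Hom(F j, B)` in `Hom(F i, B)` kept
shrinking, the witnesses would assemble to a map from `F i` to `B^ℕ`. A retraction of `B^ℕ` onto the
direct sum carries it into finitely many coordinates, because `F i` is finitely generated, and a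
coordinate outside these gives a contradiction (`exists_range_homMap_subset_succ`). For a map `g` in
the stable image, the pushout of `F i → M` along `g` is a pure monomorphism out of `B`
(`isPureMono_pushout`). It splits, and the splitting extends `g` to `M`.

From 4 to 1, a descending chain of pp-definable sets yields a countably presented module with a
generic element satisfying all the formulas. Stationarity of that module stops the chain
(`exists_ppSet_subset_of_isStationaryModule`). The chain condition passes to direct sums of copies
of `B` and implies pure-injectivity by Zorn's lemma (`IsPureModulo.exists_retraction`). -/

namespace DirectedPresentation

/-! ### Elements and relations in a direct limit. -/

variable {R : Type u} [Ring R] {M : Type w} [AddCommGroup M] [Module R M]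
  (P : DirectedPresentation R M)

theorem f_f {i j k : P.I} (hij : i ≤ j) (hjk : j ≤ k) (x : P.F i) :
    P.f j k hjk (P.f i j hij x) = P.f i k (hij.trans hjk) x :=
  DirectedSystem.map_map (f := fun i j hij => P.f i j hij) hij hjk x

theorem exists_toLimit_eq (m : M) : ∃ i x, P.toLimit i x = m := by
  obtain ⟨z, rfl⟩ := P.isLimit.2 m
  obtain ⟨i, x, rfl⟩ := Module.DirectLimit.exists_of z
  exact ⟨i, x, (Module.DirectLimit.lift_of ..).symm⟩

theorem exists_f_eq_zero {i : P.I} {x : P.F i} (hx : P.toLimit i x = 0) :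
    ∃ j, ∃ hij : i ≤ j, P.f i j hij x = 0 := by
  apply Module.DirectLimit.of.zero_exact (R := R) (f := P.f)
  apply P.isLimit.1
  rw [Module.DirectLimit.lift_of, hx, map_zero]

/-- Finitely many elements of the direct limit come from a common stage. -/
theorem exists_forall_toLimit_eq {ι : Type*} (s : Finset ι) (m : ι → M) (i₀ : P.I) :
    ∃ i, i₀ ≤ i ∧ ∃ x : ι → P.F i, ∀ k ∈ s, P.toLimit i (x k) = m k := by
  choose a y hy using fun k => P.exists_toLimit_eq (m k)
  classical
  obtain ⟨i, hi⟩ := Finset.exists_le (insert i₀ (s.image a))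
  have hk : ∀ k ∈ s, a k ≤ i := fun k hk =>
    hi _ (Finset.mem_insert_of_mem (Finset.mem_image_of_mem a hk))
  refine ⟨i, hi _ (Finset.mem_insert_self _ _),
    fun k => if h : a k ≤ i then P.f _ _ h (y k) else 0, fun k hs => ?_⟩
  simp only [dif_pos (hk k hs)]
  rw [P.compatible, hy]

/-- Finitely many elements that vanish in the direct limit vanish at a common later stage. -/
theorem exists_forall_f_eq_zero {ι : Type*} (s : Finset ι) {i : P.I} (x : ι → P.F i)
    (hx : ∀ k ∈ s, P.toLimit i (x k) = 0) :
    ∃ j, ∃ hij : i ≤ j, ∀ k ∈ s, P.f i j hij (x k) = 0 := by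
  have hex : ∀ k, ∃ j, i ≤ j ∧ (k ∈ s → ∃ hij : i ≤ j, P.f i j hij (x k) = 0) := fun k => by
    by_cases hk : k ∈ s
    · obtain ⟨j, hij, h⟩ := P.exists_f_eq_zero (hx k hk)
      exact ⟨j, hij, fun _ => ⟨hij, h⟩⟩
    · exact ⟨i, le_rfl, fun h => absurd h hk⟩
  choose a ha hz using hex
  classical
  obtain ⟨j, hj⟩ := Finset.exists_le (insert i (s.image a))
  refine ⟨j, hj _ (Finset.mem_insert_self _ _), fun k hk => ?_⟩
  obtain ⟨h, h0⟩ := hz k hk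
  rw [← P.f_f h (hj _ (Finset.mem_insert_of_mem (Finset.mem_image_of_mem a hk))), h0, map_zero]

theorem range_homMap_anti (B : Type*) [AddCommGroup B] [Module R B] {i j k : P.I}
    (hij : i ≤ j) (hjk : j ≤ k) :
    Set.range (P.homMap B (hij.trans hjk)) ⊆ Set.range (P.homMap B hij) := by
  rintro _ ⟨g, rfl⟩
  refine ⟨P.homMap B hjk g, LinearMap.ext fun x => ?_⟩
  simp [homMap, P.f_f]

end DirectedPresentation

/-! ### Every module is a direct limit of finitely presented modules. -/

section Existence

/-- The map of free modules that includes a finite set of generators of `M` among all. -/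
noncomputable abbrev Finsupp.inclGenerators (R : Type u) [Ring R] {M : Type w} (S : Finset M) :
    (S →₀ R) →ₗ[R] (M →₀ R) :=
  Finsupp.lmapDomain R R Subtype.val

theorem Finsupp.inclGenerators_comp_inclusion (R : Type u) [Ring R] {M : Type w} {S T : Finset M}
    (h : S ⊆ T) :
    inclGenerators R T ∘ₗ Finsupp.lmapDomain R R (Set.inclusion h) = inclGenerators R S := by
  rw [← Finsupp.lmapDomain_comp]
  rfl

theorem Finsupp.range_inclGenerators_mono (R : Type u) [Ring R] {M : Type w} {S T : Finset M}
    (h : S ⊆ T) : LinearMap.range (inclGenerators R S) ≤ LinearMap.range (inclGenerators R T) := by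
  rw [← inclGenerators_comp_inclusion R h]
  exact LinearMap.range_comp_le_range _ _

variable (R : Type u) [Ring R] (M : Type (max u w)) [AddCommGroup M] [Module R M]

/-- A finite set of generators of `M` together with a finitely generated module of relations
between them. -/
abbrev FinitePresentationData : Type (max u w) :=
  {p : Finset M × Submodule R (M →₀ R) // p.2.FG ∧
    p.2 ≤ LinearMap.ker (Finsupp.linearCombination R (id : M → M)) ∧
    p.2 ≤ LinearMap.range (Finsupp.inclGenerators R p.1)}

namespace FinitePresentationData

instance : Nonempty (FinitePresentationData R M) :=
  ⟨⟨(∅, ⊥), Submodule.fg_bot, bot_le, bot_le⟩⟩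

/-- Relations live in the free module on all of `M`, so an upper bound is just a union of generators
and a sum of relation modules. -/
instance : IsDirectedOrder (FinitePresentationData R M) where
  directed p q := by
    classical
    refine ⟨⟨(p.1.1 ∪ q.1.1, p.1.2 ⊔ q.1.2), p.2.1.sup q.2.1, sup_le p.2.2.1 q.2.2.1,
      sup_le (p.2.2.2.trans ?_) (q.2.2.2.trans ?_)⟩, ?_, ?_⟩
    · exact Finsupp.range_inclGenerators_mono R Finset.subset_union_left
    · exact Finsupp.range_inclGenerators_mono R Finset.subset_union_right
    · exact ⟨Finset.subset_union_left, le_sup_left⟩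
    · exact ⟨Finset.subset_union_right, le_sup_right⟩

variable {R M}

/-- The module presented by the given generators and relations. -/
abbrev toModule (p : FinitePresentationData R M) : Type (max u w) :=
  (p.1.1 →₀ R) ⧸ p.1.2.comap (Finsupp.inclGenerators R p.1.1)

instance (p : FinitePresentationData R M) : Module.FinitePresentation R p.toModule := by
  refine Module.finitePresentation_of_surjective (Submodule.mkQ _) (Submodule.mkQ_surjective _) ?_
  rw [Submodule.ker_mkQ]
  refine Submodule.fg_of_fg_map_injective (Finsupp.inclGenerators R p.1.1)
    (Finsupp.mapDomain_injective Subtype.val_injective) ?_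
  rw [Submodule.map_comap_eq, inf_eq_right.2 p.2.2.2]
  exact p.2.1

/-- The transition maps. -/
noncomputable def map (p q : FinitePresentationData R M) (h : p ≤ q) : p.toModule →ₗ[R] q.toModule :=
  Submodule.mapQ _ _ (Finsupp.lmapDomain R R (Set.inclusion h.1)) <| by
    rw [← Submodule.comap_comp, Finsupp.inclGenerators_comp_inclusion]
    exact Submodule.comap_mono h.2

/-- The map to `M`. -/
noncomputable def toBase (p : FinitePresentationData R M) : p.toModule →ₗ[R] M :=
  Submodule.liftQ _
    (Finsupp.linearCombination R (id : M → M) ∘ₗ Finsupp.inclGenerators R p.1.1)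
    fun _ hx => p.2.2.1 hx

theorem toBase_map (p q : FinitePresentationData R M) (h : p ≤ q) (x : p.toModule) :
    toBase q (map p q h x) = toBase p x := by
  obtain ⟨x, rfl⟩ := Submodule.mkQ_surjective _ x
  change Finsupp.linearCombination R (id : M → M) (Finsupp.inclGenerators R q.1.1
    (Finsupp.lmapDomain R R (Set.inclusion h.1) x)) =
      Finsupp.linearCombination R (id : M → M) (Finsupp.inclGenerators R p.1.1 x)
  rw [← Finsupp.inclGenerators_comp_inclusion R h.1, LinearMap.comp_apply]

instance : DirectedSystem (toModule (R := R) (M := M)) (fun p q h => map p q h) where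
  map_self p x := by
    obtain ⟨x, rfl⟩ := Submodule.mkQ_surjective _ x
    exact congrArg (Submodule.mkQ _) (Finsupp.mapDomain_id (v := x))
  map_map p q r hpq hqr x := by
    obtain ⟨x, rfl⟩ := Submodule.mkQ_surjective _ x
    exact congrArg (Submodule.mkQ _) (Finsupp.mapDomain_comp (v := x)
      (f := Set.inclusion hpq.1) (g := Set.inclusion hqr.1)).symm

end FinitePresentationData

open FinitePresentationData in
/-- Every module is a direct limit of finitely presented modules. -/
theorem DirectedPresentation.nonempty_presentation : Nonempty (DirectedPresentation R M) := by
  classical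
  refine ⟨{
    I := FinitePresentationData R M
    F := toModule
    f := map
    toLimit := toBase
    compatible := toBase_map
    isLimit := ⟨?_, fun m => ?_⟩ }⟩
  · intro z z' hz
    obtain ⟨p, x, x', rfl, rfl⟩ := Module.DirectLimit.exists_of₂ z z'
    rw [Module.DirectLimit.lift_of, Module.DirectLimit.lift_of] at hz
    obtain ⟨x, rfl⟩ := Submodule.mkQ_surjective _ x
    obtain ⟨x', rfl⟩ := Submodule.mkQ_surjective _ x'
    rw [← sub_eq_zero, ← map_sub, ← map_sub] at hz
    -- Two elements with equal image in `M` are identified at the stage where their difference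
    -- becomes one more relation.
    let y := Finsupp.inclGenerators R p.1.1 (x - x')
    have hy : y ∈ LinearMap.ker (Finsupp.linearCombination R (id : M → M)) := hz
    let q : FinitePresentationData R M := ⟨(p.1.1, p.1.2 ⊔ Submodule.span R {y}),
      p.2.1.sup (Submodule.fg_span_singleton _),
      sup_le p.2.2.1 ((Submodule.span_singleton_le_iff_mem ..).2 hy),
      sup_le p.2.2.2 ((Submodule.span_singleton_le_iff_mem ..).2 ⟨x - x', rfl⟩)⟩
    have hpq : p ≤ q := ⟨le_rfl, le_sup_left⟩
    have : map p q hpq (Submodule.mkQ _ x) = map p q hpq (Submodule.mkQ _ x') := by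
      rw [← sub_eq_zero, ← map_sub, ← map_sub]
      refine (Submodule.Quotient.mk_eq_zero _).2 (Submodule.mem_sup_right ?_)
      rw [show Finsupp.lmapDomain R R (Set.inclusion hpq.1) (x - x') = x - x' from
        Finsupp.mapDomain_id]
      exact Submodule.mem_span_singleton_self y
    rw [← Module.DirectLimit.of_f (hij := hpq), this, Module.DirectLimit.of_f]
  · let p : FinitePresentationData R M := ⟨({m}, ⊥), Submodule.fg_bot, bot_le, bot_le⟩
    refine ⟨Module.DirectLimit.of R _ _ _ p (Submodule.mkQ _
      (Finsupp.single ⟨m, Finset.mem_singleton_self m⟩ 1)), ?_⟩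
    rw [Module.DirectLimit.lift_of]
    change Finsupp.linearCombination R (id : M → M) (Finsupp.mapDomain Subtype.val
      (Finsupp.single _ 1)) = m
    simp

end Existence

/-! ### `Σ`-pure-injectivity implies the strict Mittag-Leffler condition. -/

section PureInjective

variable {R : Type u} [Ring R] {B : Type w} [AddCommGroup B] [Module R B]

/-- Finitely many constants have nonzero entries in only finitely many coordinates; in all others a
solution may be replaced by zero. -/
theorem isPureMono_finsupp_lcoeFun (I : Type*) :
    IsPureMono (Finsupp.lcoeFun : (I →₀ B) →ₗ[R] (I → B)) := by
  classical
  refine ⟨DFunLike.coe_injective, fun m n r a ⟨c, hc⟩ => ?_⟩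
  let S : Finset I := Finset.univ.biUnion fun i => (a i).support
  refine ⟨fun j => Finsupp.onFinset S (fun k => if k ∈ S then c j k else 0)
    fun k hk => by_contra fun h => hk (if_neg h), fun i => Finsupp.ext fun k => ?_⟩
  have h := congrFun (hc i) k
  simp only [Finset.sum_apply, Pi.smul_apply, Finsupp.lcoeFun_apply] at h
  simp only [Finsupp.finsetSum_apply, Finsupp.smul_apply, Finsupp.onFinset_apply]
  by_cases hk : k ∈ S
  · simpa [hk] using h
  · have : a i k = 0 := by
      by_contra h0
      exact hk (Finset.mem_biUnion.2 ⟨i, Finset.mem_univ _, Finsupp.mem_support_iff.2 h0⟩)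
    simp [hk, this]

theorem IsPureInjective.of_linearEquiv {B' : Type w} [AddCommGroup B'] [Module R B']
    (e : B ≃ₗ[R] B') (hB : IsPureInjective R B) : IsPureInjective R B' := by
  intro A C _ _ _ _ f hf g
  obtain ⟨h, hh⟩ := hB A C f hf (e.symm.toLinearMap ∘ₗ g)
  refine ⟨e.toLinearMap ∘ₗ h, LinearMap.ext fun x => ?_⟩
  simpa using congrArg e (LinearMap.congr_fun hh x)

theorem IsSigmaPureInjective.isPureInjective (hB : IsSigmaPureInjective R B) :
    IsPureInjective R B :=
  (hB PUnit).of_linearEquiv (Finsupp.uniqueLinearEquiv R B PUnit.unit)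

theorem LinearMap.exists_finset_lapply_comp_eq_zero {F I : Type*} [AddCommGroup F] [Module R F]
    [Module.Finite R F] (h : F →ₗ[R] (I →₀ B)) :
    ∃ S : Finset I, ∀ k ∉ S, ∀ x, h x k = 0 := by
  classical
  obtain ⟨s, hs⟩ := Module.Finite.fg_top (R := R) (M := F)
  refine ⟨s.biUnion fun x => (h x).support, fun k hk x => ?_⟩
  have : Finsupp.lapply k ∘ₗ h = 0 := by
    refine LinearMap.ext_on hs fun y hy => ?_
    by_contra h0
    exact hk (Finset.mem_biUnion.2 ⟨y, hy, Finsupp.mem_support_iff.2 h0⟩)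
  exact LinearMap.congr_fun this x

namespace DirectedPresentation

variable {M : Type w} [AddCommGroup M] [Module R M] (P : DirectedPresentation R M)

/-- A sequence of images cannot drop at every step: the retraction of the product onto the direct
sum would turn one of the witnesses into a map that extends one stage further. -/
theorem exists_range_homMap_subset_succ (hB : IsSigmaPureInjective R B) {i : P.I} (j : ℕ → P.I)
    (hj : Monotone j) (hij : ∀ n, i ≤ j n) :
    ∃ n, Set.range (P.homMap B (hij n)) ⊆ Set.range (P.homMap B (hij (n + 1))) := by
  by_contra! hcon
  choose g hg hg' using fun n => Set.not_subset.1 (hcon n)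
  obtain ⟨p, hp⟩ := hB (ULift ℕ) _ _ _ (isPureMono_finsupp_lcoeFun (ULift ℕ)) LinearMap.id
  let γ : P.F i →ₗ[R] (ULift ℕ → B) := LinearMap.pi fun k => g k.down
  obtain ⟨S, hS⟩ := (p ∘ₗ γ).exists_finset_lapply_comp_eq_zero
  -- At a coordinate `N` outside `S`, the composite `p ∘ₗ γ` vanishes.
  obtain ⟨N', hN'⟩ := Infinite.exists_notMem_finset S
  obtain ⟨N⟩ := N'
  have hlift : ∀ k, ∃ t : P.F (j (N + 1)) →ₗ[R] B,
      N < k → P.homMap B (hij (N + 1)) t = g k := fun k => by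
    by_cases hk : N < k
    · obtain ⟨t, ht⟩ := P.range_homMap_anti B (hij (N + 1)) (hj hk) (hg k)
      exact ⟨t, fun _ => ht⟩
    · exact ⟨0, fun h => absurd h hk⟩
  choose t ht using hlift
  let τ : P.F (j (N + 1)) →ₗ[R] (ULift ℕ → B) :=
    LinearMap.pi fun k => if N < k.down then t k.down else 0
  -- Up to the head `s` (coordinates at most `N`), which `p` fixes, `γ` is the tail `τ` applied
  -- after the transition map. Coordinate `N` of `p` then reads `0 = g N x + p (τ (f x)) N`.
  refine hg' N ⟨-(Finsupp.lapply ⟨N⟩ ∘ₗ p ∘ₗ τ), LinearMap.ext fun x => ?_⟩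
  let s : ULift ℕ →₀ B :=
    ∑ k ∈ Finset.range (N + 1), Finsupp.single (ULift.up k) (g k x)
  have hs : ∀ k, s k = if k.down < N + 1 then g k.down x else 0 := fun ⟨k⟩ => by
    simp [s, Finsupp.finsetSum_apply, Finsupp.single_apply]
  have key : γ x = Finsupp.lcoeFun (R := R) s + τ (P.f i _ (hij (N + 1)) x) := by
    funext k
    rw [Pi.add_apply, Finsupp.lcoeFun_apply, hs]
    by_cases hk : N < k.down
    · simp only [γ, τ, LinearMap.pi_apply, if_pos hk, if_neg (show ¬ k.down < N + 1 by omega),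
        zero_add, ← ht k.down hk]
      rfl
    · simp only [γ, τ, LinearMap.pi_apply, if_neg hk, if_pos (show k.down < N + 1 by omega),
        LinearMap.zero_apply, add_zero]
  have h1 := congrArg (fun z => p z ⟨N⟩) key
  have h2 : p (Finsupp.lcoeFun (R := R) s) = s := LinearMap.congr_fun hp s
  have h3 : p (γ x) ⟨N⟩ = 0 := hS _ hN' x
  simp only [map_add, h2, Finsupp.add_apply, hs, h3, if_pos (Nat.lt_succ_self N)] at h1
  simpa [homMap] using (eq_neg_of_add_eq_zero_left h1.symm).symm

/-- If `B` is `Σ`-pure-injective, every inverse system `Hom(F i, B)` is Mittag-Leffler. -/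
theorem isMittagLeffler (hB : IsSigmaPureInjective R B) : IsMittagLeffler (P.homMap B) := by
  intro i
  by_contra! hcon
  choose k hk hne using hcon
  let s : ℕ → {j // i ≤ j} := fun n =>
    Nat.rec ⟨i, le_rfl⟩ (fun _ j => ⟨k j.1 j.2, j.2.trans (hk j.1 j.2)⟩) n
  have hs : ∀ n, (s n).1 ≤ (s (n + 1)).1 := fun n => hk _ _
  obtain ⟨n, hn⟩ := P.exists_range_homMap_subset_succ hB (fun n => (s n).1)
    (monotone_nat_of_le_succ hs) (fun n => (s n).2)
  exact hne _ _ (hn.antisymm (P.range_homMap_anti B (s n).2 (hs n)))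

/-- If a map `F i → B` extends to all later stages, then the pushout of `F i → M` along it is a
pure monomorphism. -/
theorem isPureMono_pushout {i : P.I} (g : P.F i →ₗ[R] B)
    (hg : ∀ k, ∃ l, k ≤ l ∧ ∃ hil : i ≤ l, g ∈ Set.range (P.homMap B hil)) :
    IsPureMono (Submodule.mkQ (LinearMap.range (g.prod (-P.toLimit i))) ∘ₗ
      LinearMap.inl R B M) := by
  constructor
  · rw [injective_iff_map_eq_zero]
    intro b hb
    obtain ⟨x, hx⟩ := (Submodule.Quotient.mk_eq_zero _).1 hb
    obtain ⟨hx1, hx2⟩ := Prod.mk.inj hx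
    have hx0 : P.toLimit i x = 0 := neg_eq_zero.1 hx2
    obtain ⟨k, hik, hk⟩ := P.exists_f_eq_zero hx0
    obtain ⟨l, hkl, hil, h, rfl⟩ := hg k
    refine (show _ = b from hx1).symm.trans ?_
    change h (P.f i l hil x) = 0
    rw [← P.f_f hik hkl, hk, map_zero, map_zero]
  · rintro m n r a ⟨c, hc⟩
    choose c' hc' using fun j => Submodule.mkQ_surjective _ (c j)
    have hex : ∀ k, ∃ x : P.F i, g x = ∑ j, r k j • (c' j).1 - a k ∧
        -P.toLimit i x = ∑ j, r k j • (c' j).2 := fun k => by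
      have h0 : ∑ j, r k j • c' j - (a k, 0) ∈ LinearMap.range (g.prod (-P.toLimit i)) := by
        rw [← Submodule.ker_mkQ (LinearMap.range _), LinearMap.mem_ker, map_sub, map_sum,
          sub_eq_zero]
        simp only [map_smul, hc']
        exact hc k
      obtain ⟨x, hx⟩ := h0
      obtain ⟨h1, h2⟩ := Prod.mk.inj hx
      exact ⟨x, by simpa [Prod.fst_sum] using h1, by simpa [Prod.snd_sum] using h2⟩
    choose x hx1 hx2 using hex
    obtain ⟨k₀, hk₀, y, hy⟩ := P.exists_forall_toLimit_eq Finset.univ (fun j => (c' j).2) i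
    obtain ⟨k₁, hk₁, hz⟩ := P.exists_forall_f_eq_zero Finset.univ
      (fun k => ∑ j, r k j • y j + P.f i k₀ hk₀ (x k)) (fun k _ => by
        simp only [map_add, map_sum, map_smul, P.compatible, hy _ (Finset.mem_univ _)]
        rw [← hx2, neg_add_cancel])
    obtain ⟨l, hkl, hil, h, hh⟩ := hg k₁
    -- The `M`-components of the solution, lifted to a stage where their equations hold, are carried
    -- into `B` by an extension `h` of `g`; the error terms `g (x k)` then cancel.
    refine ⟨fun j => (c' j).1 + h (P.f k₀ l (hk₁.trans hkl) (y j)), fun k => ?_⟩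
    have h0 := congrArg (fun z => h (P.f k₁ l hkl z)) (hz k (Finset.mem_univ _))
    simp only [map_add, map_sum, map_smul, P.f_f, map_zero] at h0
    have hgx : g (x k) = h (P.f i l hil (x k)) := by rw [← hh]; rfl
    rw [← hgx, hx1] at h0
    simp only [smul_add, Finset.sum_add_distrib]
    rw [← sub_eq_zero, ← h0]
    abel

/-- If `B` is `Σ`-pure-injective, every inverse system `Hom(F i, B)` is strict Mittag-Leffler. -/
theorem isStrictMittagLeffler (hB : IsSigmaPureInjective R B) :
    IsStrictMittagLeffler (P.homMap B) (P.homLimitMap B) := by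
  intro i
  obtain ⟨j, hij, hj⟩ := P.isMittagLeffler hB i
  refine ⟨j, hij, hj, Set.Subset.antisymm ?_ ?_⟩
  · intro g hg
    -- A retraction of the pushout onto `B`, restricted to `M`, is the required extension of `g`.
    obtain ⟨h, hh⟩ := hB.isPureInjective _ _ _ (P.isPureMono_pushout g fun k => by
      obtain ⟨l, hjl, hkl⟩ := exists_ge_ge j k
      exact ⟨l, hkl, hij.trans hjl, hj l hjl ▸ hg⟩) LinearMap.id
    refine ⟨h ∘ₗ Submodule.mkQ _ ∘ₗ LinearMap.inr R B M, LinearMap.ext fun x => ?_⟩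
    have hx := LinearMap.congr_fun hh (g x)
    rw [LinearMap.id_apply] at hx
    rw [← hx]
    refine congrArg h (Eq.symm ((Submodule.Quotient.eq _).2 ⟨x, ?_⟩))
    simp
  · rintro _ ⟨g, rfl⟩
    exact ⟨g ∘ₗ P.toLimit j, LinearMap.ext fun x => congrArg g (P.compatible i j hij x)⟩

end DirectedPresentation

end PureInjective

/-! ### Positive primitive formulas and their descending chain condition. -/

section PpDefinable

variable {R : Type u} [Ring R]

/-- The subset of `D` defined by the positive primitive formula that asserts the existence of a
solution of the finite homogeneous system `T` in variables `x₀, x₁, …` with prescribed `x₀`. -/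
def ppSet (D : Type*) [AddCommGroup D] [Module R D] (T : Finset (ℕ →₀ R)) : Set D :=
  {d | ∃ h : (ℕ →₀ R) →ₗ[R] D, h (Finsupp.single 0 1) = d ∧ ∀ ρ ∈ T, h ρ = 0}

/-- The descending chain condition for the subsets of `D` defined by positive primitive formulas. -/
def HasPpDescendingChainCondition (R : Type u) [Ring R] (D : Type*) [AddCommGroup D]
    [Module R D] : Prop :=
  WellFounded fun T T' : Finset (ℕ →₀ R) => ppSet D T ⊂ ppSet D T'

/-- Renaming of variables that keeps the variable `0` and makes all others disjoint for
different values of `k`. -/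
def renameVar (k : ℕ) : ℕ → ℕ
  | 0 => 0
  | j + 1 => Nat.pair k j + 1

/-- The map of free modules induced by `renameVar`. -/
noncomputable abbrev renameMap (R : Type u) [Ring R] (k : ℕ) : (ℕ →₀ R) →ₗ[R] (ℕ →₀ R) :=
  Finsupp.lmapDomain R R (renameVar k)

theorem renameMap_single_zero (k : ℕ) :
    renameMap R k (Finsupp.single 0 1) = Finsupp.single 0 1 :=
  Finsupp.mapDomain_single

/-- Solutions of infinitely many systems with a common value of `x₀` can be combined. -/
theorem exists_comp_renameMap {D : Type*} [AddCommGroup D] [Module R D]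
    (h : ℕ → (ℕ →₀ R) →ₗ[R] D) (d : D) (hd : ∀ k, h k (Finsupp.single 0 1) = d) :
    ∃ H : (ℕ →₀ R) →ₗ[R] D, ∀ k, H ∘ₗ renameMap R k = h k := by
  refine ⟨Finsupp.linearCombination R fun t => Nat.casesOn t d fun t =>
    h t.unpair.1 (Finsupp.single (t.unpair.2 + 1) 1), fun k => ?_⟩
  refine Finsupp.lhom_ext' fun t => LinearMap.ext_ring ?_
  cases t with
  | zero => simp [renameVar, hd]
  | succ t => simp [renameVar]

theorem ppSet_subset_of_image_renameMap_subset [DecidableEq (ℕ →₀ R)] {D : Type*} [AddCommGroup D]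
    [Module R D] {T T' : Finset (ℕ →₀ R)} {k : ℕ} (h : T.image (renameMap R k) ⊆ T') :
    ppSet D T' ⊆ ppSet D T := by
  rintro d ⟨g, hg, hT⟩
  refine ⟨g ∘ₗ renameMap R k, ?_, fun ρ hρ => hT _ (h (Finset.mem_image_of_mem _ hρ))⟩
  rw [LinearMap.comp_apply, renameMap_single_zero, hg]

theorem mem_ppSet_finsupp {I : Type*} {B : Type*} [AddCommGroup B] [Module R B]
    {T : Finset (ℕ →₀ R)} {d : I →₀ B} : d ∈ ppSet (I →₀ B) T ↔ ∀ i, d i ∈ ppSet B T := by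
  constructor
  · rintro ⟨h, rfl, hT⟩ i
    exact ⟨Finsupp.lapply i ∘ₗ h, rfl, fun ρ hρ => by simp [hT ρ hρ]⟩
  · intro hd
    choose h h0 hT using hd
    refine ⟨∑ i ∈ d.support, Finsupp.lsingle i ∘ₗ h i, ?_, fun ρ hρ => ?_⟩
    · simp only [LinearMap.sum_apply, LinearMap.comp_apply, h0, Finsupp.lsingle_apply]
      exact Finsupp.sum_single d
    · simp [LinearMap.sum_apply, hT _ ρ hρ]

/-- Membership is tested coordinatewise, so a strict inclusion for the direct sum forces a strict
inclusion for `B` between the same two formulas. -/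
theorem HasPpDescendingChainCondition.finsupp {B : Type*} [AddCommGroup B] [Module R B]
    (hB : HasPpDescendingChainCondition R B) (I : Type*) :
    HasPpDescendingChainCondition R (I →₀ B) := by
  refine Subrelation.wf (fun {T T'} h => ?_) hB
  obtain ⟨d, hd', hd⟩ := Set.exists_of_ssubset h
  rw [mem_ppSet_finsupp] at hd hd'
  obtain ⟨i, hi⟩ := not_forall.1 hd
  refine ⟨fun b hb => ?_, fun hs => hi (hs (hd' i))⟩
  have : Finsupp.single i b ∈ ppSet (I →₀ B) T := by
    rw [mem_ppSet_finsupp]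
    intro k
    by_cases hk : i = k
    · subst hk; simpa using hb
    · rw [Finsupp.single_eq_of_ne' hk]
      exact ⟨0, rfl, fun _ _ => rfl⟩
  simpa using mem_ppSet_finsupp.1 (h.1 this) i

/-! ### Pure-injectivity from the chain condition, by Zorn's lemma. -/

theorem Submodule.FG.exists_le_of_le_sSup {M : Type*} [AddCommGroup M] [Module R M]
    {N : Submodule R M} (hN : N.FG) {s : Set (Submodule R M)} (hs : s.Nonempty)
    (hdir : DirectedOn (· ≤ ·) s) (h : N ≤ sSup s) : ∃ K ∈ s, N ≤ K :=
  (CompleteLattice.isCompactElement_iff_le_of_directed_sSup_le _ N).1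
    ((Submodule.fg_iff_compact N).1 hN) s hs hdir h

/-- Every finite linear system with constants in `D` that is solvable in `E` modulo `K` is solvable
in `D`. -/
def IsPureModulo {D E : Type*} [AddCommGroup D] [Module R D] [AddCommGroup E] [Module R E]
    (f : D →ₗ[R] E) (K : Submodule R E) : Prop :=
  ∀ T : Finset ((ℕ →₀ R) × D), (∃ h : (ℕ →₀ R) →ₗ[R] E, ∀ p ∈ T, h p.1 - f p.2 ∈ K) →
    ∃ h : (ℕ →₀ R) →ₗ[R] D, ∀ p ∈ T, h p.1 = p.2

namespace IsPureModulo

variable {D E : Type*} [AddCommGroup D] [Module R D] [AddCommGroup E] [Module R E]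
  {f : D →ₗ[R] E} {K : Submodule R E}

/-- This is purity for the equation `0 = d`, which contains no variables. -/
theorem eq_zero_of_mem (hK : IsPureModulo f K) {d : D} (hd : f d ∈ K) : d = 0 := by
  obtain ⟨h, hh⟩ := hK {(0, d)} ⟨0, by simpa using hd⟩
  simpa using (hh _ (Finset.mem_singleton_self _)).symm

theorem sSup {s : Set (Submodule R E)} (hs : s.Nonempty) (hc : IsChain (· ≤ ·) s)
    (h : ∀ K ∈ s, IsPureModulo f K) : IsPureModulo f (sSup s) := by
  classical
  rintro T ⟨g, hg⟩
  obtain ⟨K, hK, hle⟩ := Submodule.FG.exists_le_of_le_sSup (R := R)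
    (Submodule.fg_span (T.image fun p => g p.1 - f p.2).finite_toSet) hs hc.directedOn (by
      rw [Submodule.span_le]
      intro x hx
      obtain ⟨p, hp, rfl⟩ := Finset.mem_image.1 (Finset.mem_coe.1 hx)
      exact hg p hp)
  exact h K hK T ⟨g, fun p hp => hle (Submodule.subset_span
    (Finset.mem_coe.2 (Finset.mem_image_of_mem (fun p => g p.1 - f p.2) hp)))⟩

/-- With the descending chain condition, an element of `E` can be replaced by an element of `D`
that satisfies all formulas which hold for it modulo `K`. -/
theorem exists_forall_system (hD : HasPpDescendingChainCondition R D) (hK : IsPureModulo f K)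
    (c : E) : ∃ d : D, ∀ T : Finset ((ℕ →₀ R) × D),
      (∃ h : (ℕ →₀ R) →ₗ[R] E, h (Finsupp.single 0 1) = c ∧ ∀ p ∈ T, h p.1 - f p.2 ∈ K) →
        ∃ h : (ℕ →₀ R) →ₗ[R] D, h (Finsupp.single 0 1) = d ∧ ∀ p ∈ T, h p.1 = p.2 := by
  classical
  let S : Set (Finset (ℕ →₀ R)) := {T' | ∃ T : Finset ((ℕ →₀ R) × D), T.image Prod.fst = T' ∧
    ∃ h : (ℕ →₀ R) →ₗ[R] E, h (Finsupp.single 0 1) = c ∧ ∀ p ∈ T, h p.1 - f p.2 ∈ K}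
  have hS : S.Nonempty := ⟨∅, ∅, rfl, Finsupp.linearCombination R fun _ => c, by simp, by simp⟩
  -- Among the systems that `c` satisfies modulo `K`, take one whose homogeneous part defines a
  -- minimal subset of `D`. Any solution of it in `D` supplies the value `d`.
  obtain ⟨_, ⟨T₀, rfl, h₀, h₀c, h₀K⟩, hmin⟩ := hD.has_min S hS
  obtain ⟨g₀, hg₀⟩ := hK T₀ ⟨h₀, h₀K⟩
  refine ⟨g₀ (Finsupp.single 0 1), fun T ⟨h, hc, hT⟩ => ?_⟩
  let ren : ℕ → (ℕ →₀ R) × D → (ℕ →₀ R) × D := fun k p => (renameMap R k p.1, p.2)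
  let T' := T₀.image (ren 0) ∪ T.image (ren 1)
  obtain ⟨H, hH⟩ := exists_comp_renameMap (fun k => if k = 0 then h₀ else h) c
    (fun k => by split_ifs <;> assumption)
  have hHK : ∀ p ∈ T', H p.1 - f p.2 ∈ K := fun p hp => by
    rcases Finset.mem_union.1 hp with hp | hp <;> obtain ⟨q, hq, rfl⟩ := Finset.mem_image.1 hp
    · have := LinearMap.congr_fun (hH 0) q.1
      simp only [LinearMap.comp_apply, if_true] at this
      rw [this]
      exact h₀K q hq
    · have := LinearMap.congr_fun (hH 1) q.1
      simp only [LinearMap.comp_apply, one_ne_zero, if_false] at this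
      rw [this]
      exact hT q hq
  have hHc : H (Finsupp.single 0 1) = c := by
    have := LinearMap.congr_fun (hH 0) (Finsupp.single 0 1)
    rwa [LinearMap.comp_apply, renameMap_single_zero, if_pos rfl, h₀c] at this
  have hsub : ppSet D (T'.image Prod.fst) ⊆ ppSet D (T₀.image Prod.fst) := by
    refine ppSet_subset_of_image_renameMap_subset (k := 0) fun ρ hρ => ?_
    simp only [Finset.mem_image] at hρ ⊢
    obtain ⟨_, ⟨p, hp, rfl⟩, rfl⟩ := hρ
    exact ⟨ren 0 p, Finset.mem_union_left _ (Finset.mem_image_of_mem _ hp), rfl⟩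
  have hsup : ppSet D (T₀.image Prod.fst) ⊆ ppSet D (T'.image Prod.fst) := by
    by_contra hn
    exact hmin _ ⟨T', rfl, H, hHc, hHK⟩ ⟨hsub, hn⟩
  obtain ⟨G, hG⟩ := hK T' ⟨H, hHK⟩
  -- The two values of `x₀` differ by a homogeneous solution of `T₀`, and by minimality this
  -- difference also extends to a homogeneous solution of the joint system. Adding it to `G`
  -- corrects the value to `d`.
  obtain ⟨k, hk0, hk⟩ : g₀ (Finsupp.single 0 1) - G (Finsupp.single 0 1) ∈
      ppSet D (T'.image Prod.fst) := by
    refine hsup ⟨g₀ - G ∘ₗ renameMap R 0, ?_, fun ρ hρ => ?_⟩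
    · rw [LinearMap.sub_apply, LinearMap.comp_apply, renameMap_single_zero]
    · obtain ⟨p, hp, rfl⟩ := Finset.mem_image.1 hρ
      rw [LinearMap.sub_apply, hg₀ p hp, sub_eq_zero]
      exact (hG (ren 0 p) (Finset.mem_union_left _ (Finset.mem_image_of_mem _ hp))).symm
  refine ⟨(G + k) ∘ₗ renameMap R 1, ?_, fun p hp => ?_⟩
  · rw [LinearMap.comp_apply, renameMap_single_zero, LinearMap.add_apply, hk0, add_sub_cancel]
  · have hp' : ren 1 p ∈ T' := Finset.mem_union_right _ (Finset.mem_image_of_mem _ hp)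
    rw [LinearMap.comp_apply, LinearMap.add_apply,
      hk _ (Finset.mem_image_of_mem Prod.fst hp'), add_zero]
    exact hG _ hp'

/-- A congruence modulo the larger submodule becomes one modulo `K` after subtracting a multiple of
`c - f d`. This makes `c` a parameter, for which `d` can be substituted in `D`. -/
theorem exists_sup_span (hD : HasPpDescendingChainCondition R D) (hK : IsPureModulo f K)
    (c : E) : ∃ d : D, IsPureModulo f (K ⊔ Submodule.span R {c - f d}) := by
  classical
  obtain ⟨d, hd⟩ := hK.exists_forall_system hD c
  refine ⟨d, ?_⟩
  rintro T ⟨h, hT⟩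
  have hex : ∀ p, ∃ t : R, p ∈ T → h p.1 - f p.2 - t • (c - f d) ∈ K := fun p => by
    by_cases hp : p ∈ T
    · obtain ⟨y, hy, z, hz, hyz⟩ := Submodule.mem_sup.1 (hT p hp)
      obtain ⟨t, rfl⟩ := Submodule.mem_span_singleton.1 hz
      exact ⟨t, fun _ => by rwa [← hyz, add_sub_cancel_right]⟩
    · exact ⟨0, fun h => absurd h hp⟩
  choose t ht using hex
  -- Shifting the old variables by one frees `x₀` for `c`.
  let sh : (ℕ →₀ R) →ₗ[R] (ℕ →₀ R) := Finsupp.lmapDomain R R Nat.succ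
  let tr : (ℕ →₀ R) × D → (ℕ →₀ R) × D := fun p =>
    (sh p.1 - t p • Finsupp.single 0 1, p.2 - t p • d)
  let H : (ℕ →₀ R) →ₗ[R] E := Finsupp.linearCombination R fun n =>
    Nat.casesOn n c fun n => h (Finsupp.single n 1)
  have hH0 : H (Finsupp.single 0 1) = c := by simp [H]
  have hHsh : H ∘ₗ sh = h := Finsupp.lhom_ext' fun n => LinearMap.ext_ring (by simp [H, sh])
  obtain ⟨g, hg0, hg⟩ := hd (T.image tr) ⟨H, hH0, fun q hq => by
    obtain ⟨p, hp, rfl⟩ := Finset.mem_image.1 hq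
    have h1 : H (sh p.1) = h p.1 := LinearMap.congr_fun hHsh p.1
    convert ht p hp using 1
    simp only [tr, map_sub, map_smul, hH0, h1, smul_sub]
    abel⟩
  refine ⟨g ∘ₗ sh, fun p hp => ?_⟩
  have := hg _ (Finset.mem_image_of_mem tr hp)
  simp only [tr, map_sub, map_smul, hg0] at this
  exact sub_left_injective this

/-- For a maximal `L` above `K`, every `c` is congruent modulo `L` to `f d` for some `d`, by
maximality, and `d` is unique, by purity. Sending `c` to `d` is the retraction. -/
theorem exists_retraction (hD : HasPpDescendingChainCondition R D) (hK : IsPureModulo f K) :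
    ∃ r : E →ₗ[R] D, r ∘ₗ f = LinearMap.id ∧ K ≤ LinearMap.ker r := by
  obtain ⟨L, hKL, hL, hmax⟩ := zorn_le_nonempty₀ {L | IsPureModulo f L}
    (fun s hs hc y hy => ⟨_, IsPureModulo.sSup ⟨y, hy⟩ hc hs, fun _ => le_sSup⟩) K hK
  have hex : ∀ c, ∃ d, c - f d ∈ L := fun c => by
    obtain ⟨d, hd⟩ := IsPureModulo.exists_sup_span hD hL c
    exact ⟨d, hmax hd le_sup_left (Submodule.mem_sup_right (Submodule.mem_span_singleton_self _))⟩
  choose r hr using hex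
  have huniq : ∀ c d, c - f d ∈ L → r c = d := fun c d h => by
    rw [← sub_eq_zero]
    refine IsPureModulo.eq_zero_of_mem hL ?_
    have := L.sub_mem h (hr c)
    rwa [sub_sub_sub_cancel_left, ← map_sub] at this
  refine ⟨{ toFun := r, map_add' := fun c c' => ?_, map_smul' := fun t c => ?_ }, ?_, ?_⟩
  · refine huniq _ _ ?_
    rw [map_add, add_sub_add_comm]
    exact L.add_mem (hr c) (hr c')
  · refine huniq _ _ ?_
    rw [RingHom.id_apply, map_smul, ← smul_sub]
    exact L.smul_mem t (hr c)
  · exact LinearMap.ext fun d => huniq _ _ (by simp)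
  · exact fun c hc => huniq _ _ (by simpa using hKL hc)

end IsPureModulo

theorem Finsupp.sum_fin_smul_eq_linearCombination {X : Type*} [AddCommGroup X] [Module R X] {n : ℕ}
    {ρ : ℕ →₀ R} (hρ : ρ.support ⊆ Finset.range n) (v : ℕ → X) :
    ∑ j : Fin n, ρ j • v j = Finsupp.linearCombination R v ρ := by
  rw [Finsupp.linearCombination_apply, Finsupp.sum_of_support_subset _ hρ _ (by simp),
    Fin.sum_univ_eq_sum_range (fun j => ρ j • v j)]

theorem IsPureMono.exists_linearMap {A C : Type*} [AddCommGroup A] [Module R A] [AddCommGroup C]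
    [Module R C] {f : A →ₗ[R] C} (hf : IsPureMono f) {ι : Type*} (T : Finset ι)
    (ρ : ι → ℕ →₀ R) (α : ι → A) (h : (ℕ →₀ R) →ₗ[R] C) (hh : ∀ p ∈ T, h (ρ p) = f (α p)) :
    ∃ g : (ℕ →₀ R) →ₗ[R] A, ∀ p ∈ T, g (ρ p) = α p := by
  classical
  obtain ⟨n, hn⟩ : ∃ n, ∀ p ∈ T, (ρ p).support ⊆ Finset.range n := by
    obtain ⟨n, hn⟩ := Finset.exists_nat_subset_range (T.biUnion fun p => (ρ p).support)
    exact ⟨n, fun p hp => (Finset.subset_biUnion_of_mem (fun p => (ρ p).support) hp).trans hn⟩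
  have hh' : h = Finsupp.linearCombination R fun j => h (Finsupp.single j 1) :=
    Finsupp.lhom_ext' fun n => LinearMap.ext_ring (by simp)
  obtain ⟨x, hx⟩ := hf.2 T.card n (fun i j => ρ (T.equivFin.symm i) j)
    (fun i => α (T.equivFin.symm i)) ⟨fun j => h (Finsupp.single (j : ℕ) 1), fun i => by
      rw [Finsupp.sum_fin_smul_eq_linearCombination (hn _ (T.equivFin.symm i).2)
        (fun j => h (Finsupp.single j 1)), ← hh', hh _ (T.equivFin.symm i).2]⟩
  refine ⟨Finsupp.linearCombination R fun j => if hj : j < n then x ⟨j, hj⟩ else 0,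
    fun p hp => ?_⟩
  have := hx (T.equivFin ⟨p, hp⟩)
  rw [Equiv.symm_apply_apply] at this
  rw [← Finsupp.sum_fin_smul_eq_linearCombination (hn p hp), ← this]
  simp

/-- A module with the descending chain condition on subsets defined by positive primitive formulas
is pure-injective. -/
theorem HasPpDescendingChainCondition.isPureInjective {D : Type w} [AddCommGroup D] [Module R D]
    (hD : HasPpDescendingChainCondition R D) : IsPureInjective R D := by
  intro A C _ _ _ _ f hf g
  -- This is purity of `D` in the pushout of `f` and `g`, written as a statement about `D × C`
  -- modulo the pushout relations.
  have hK : IsPureModulo (LinearMap.inl R D C) (LinearMap.range (g.prod (-f))) := by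
    rintro T ⟨h, hh⟩
    choose! a ha using hh
    have ha1 : ∀ p ∈ T, g (a p) = (h p.1).1 - p.2 := fun p hp => by
      simpa using congrArg Prod.fst (ha p hp)
    have ha2 : ∀ p ∈ T, -f (a p) = (h p.1).2 := fun p hp => by
      simpa using congrArg Prod.snd (ha p hp)
    obtain ⟨k, hk⟩ := hf.exists_linearMap T Prod.fst (fun p => -a p) (LinearMap.snd R D C ∘ₗ h)
      fun p hp => by simp [← ha2 p hp]
    refine ⟨LinearMap.fst R D C ∘ₗ h + g ∘ₗ k, fun p hp => ?_⟩
    simp [hk p hp, ha1 p hp]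
  obtain ⟨r, hr, hKr⟩ := hK.exists_retraction hD
  refine ⟨r ∘ₗ LinearMap.inr R D C, LinearMap.ext fun a => ?_⟩
  have h1 : r (g a, -f a) = 0 := hKr ⟨a, rfl⟩
  have h2 : r (g a, 0) = g a := LinearMap.congr_fun hr (g a)
  have h3 : ((g a, -f a) : D × C) = (g a, 0) - (0, f a) := by simp
  rw [h3, map_sub, h2, sub_eq_zero] at h1
  exact h1.symm

theorem HasPpDescendingChainCondition.isSigmaPureInjective {B : Type w} [AddCommGroup B]
    [Module R B] (hB : HasPpDescendingChainCondition R B) : IsSigmaPureInjective R B :=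
  fun I => (hB.finsupp I).isPureInjective

end PpDefinable

/-! ### Stationarity of countably presented modules implies the chain condition. -/

section Stationary

variable {R : Type u} [Ring R]

/-- A map from a finitely presented module to `V ⧸ N`, with prescribed value at one element, lifts
to `V ⧸ N n` for some `n` when `N` is the directed union of the `N n` and `V` is projective. -/
theorem Module.FinitePresentation.exists_lift_quotient_iSup {V F : Type*} [AddCommGroup V]
    [Module R V] [Module.Projective R V] [AddCommGroup F] [Module R F]
    [Module.FinitePresentation R F] (N : ℕ → Submodule R V) (hN : Monotone N)
    (φ : F →ₗ[R] V ⧸ (⨆ n, N n)) (e : F) (v : V) (he : φ e = Submodule.mkQ _ v) :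
    ∃ n, ∃ ψ : F →ₗ[R] V ⧸ N n, ψ e = Submodule.mkQ _ v := by
  obtain ⟨a, p, hp⟩ := Module.Finite.exists_fin' R F
  obtain ⟨θ, hθ⟩ := Module.projective_lifting_property (Submodule.mkQ (⨆ n, N n)) (φ ∘ₗ p)
    (Submodule.mkQ_surjective _)
  obtain ⟨e', rfl⟩ := hp e
  have hθ' : ∀ x, Submodule.mkQ (⨆ n, N n) (θ x) = φ (p x) := LinearMap.congr_fun hθ
  have hfg : ((LinearMap.ker p).map θ ⊔ Submodule.span R {θ e' - v}).FG :=
    ((Module.FinitePresentation.fg_ker p hp).map θ).sup (Submodule.fg_span_singleton _)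
  obtain ⟨_, ⟨n, rfl⟩, hn⟩ := hfg.exists_le_of_le_sSup (Set.range_nonempty N)
    (directedOn_range.2 hN.directed_le) (by
      refine sup_le ?_ ?_
      · rw [Submodule.map_le_iff_le_comap]
        intro x hx
        refine (Submodule.Quotient.mk_eq_zero (⨆ n, N n)).1 ((hθ' x).trans ?_)
        rw [LinearMap.mem_ker.1 hx, map_zero]
      · rw [Submodule.span_singleton_le_iff_mem]
        exact (Submodule.Quotient.eq (⨆ n, N n)).1 ((hθ' e').trans he))
  have hker : LinearMap.ker p ≤ LinearMap.ker (Submodule.mkQ (N n) ∘ₗ θ) := fun x hx =>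
    (Submodule.Quotient.mk_eq_zero (N n)).2
      (hn (Submodule.mem_sup_left (Submodule.mem_map_of_mem hx)))
  refine ⟨n, (LinearMap.ker p).liftQ _ hker ∘ₗ (p.quotKerEquivOfSurjective hp).symm.toLinearMap,
    ?_⟩
  have : (p.quotKerEquivOfSurjective hp).symm (p e') = Submodule.mkQ _ e' := by
    rw [LinearEquiv.symm_apply_eq]
    rfl
  rw [LinearMap.comp_apply, LinearEquiv.coe_coe, this, Submodule.mkQ_apply, Submodule.liftQ_apply]
  exact (Submodule.Quotient.eq (N n)).2
    (hn (Submodule.mem_sup_right (Submodule.mem_span_singleton_self _)))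

/-- A solution in `M` of a finite system whose first variable comes from the stage `i` comes from
a solution at a later stage. -/
theorem DirectedPresentation.exists_ppSet {M : Type w} [AddCommGroup M] [Module R M]
    (P : DirectedPresentation R M) {T : Finset (ℕ →₀ R)} {i : P.I} {e : P.F i}
    (he : P.toLimit i e ∈ ppSet M T) :
    ∃ k, ∃ hik : i ≤ k, P.f i k hik e ∈ ppSet (P.F k) T := by
  classical
  obtain ⟨q, hq, hT⟩ := he
  obtain ⟨k₀, hk₀, y, hy⟩ := P.exists_forall_toLimit_eq
    (insert 0 (T.biUnion Finsupp.support)) (fun t => q (Finsupp.single t 1)) i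
  let q₀ := Finsupp.linearCombination R y
  have hq₀ : ∀ ρ ∈ T, P.toLimit k₀ (q₀ ρ) = 0 := fun ρ hρ => by
    rw [← hT ρ hρ]
    conv_rhs => rw [← Finsupp.sum_single ρ]
    rw [Finsupp.linearCombination_apply, Finsupp.sum, Finsupp.sum, map_sum, map_sum]
    refine Finset.sum_congr rfl fun t ht => ?_
    rw [map_smul, hy t (Finset.mem_insert_of_mem (Finset.mem_biUnion.2 ⟨ρ, hρ, ht⟩)), ← map_smul,
      Finsupp.smul_single_one]
  obtain ⟨k₁, hk₁, h₁⟩ := P.exists_forall_f_eq_zero T (fun ρ => q₀ ρ) hq₀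
  obtain ⟨k₂, hk₂, h₂⟩ := P.exists_f_eq_zero (i := k₀) (x := y 0 - P.f i k₀ hk₀ e) (by
    rw [map_sub, P.compatible, hy 0 (Finset.mem_insert_self _ _), hq, sub_self])
  obtain ⟨k, hk₁k, hk₂k⟩ := exists_ge_ge k₁ k₂
  refine ⟨k, hk₀.trans (hk₁.trans hk₁k), P.f k₀ k (hk₁.trans hk₁k) ∘ₗ q₀, ?_, fun ρ hρ => ?_⟩
  · have := congrArg (P.f k₂ k hk₂k) h₂
    rw [P.f_f, map_sub, map_zero, P.f_f, sub_eq_zero] at this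
    simpa [q₀] using this
  · rw [LinearMap.comp_apply, ← P.f_f hk₁ hk₁k, h₁ ρ hρ, map_zero]

theorem map_mem_ppSet {D E : Type*} [AddCommGroup D] [Module R D] [AddCommGroup E] [Module R E]
    (g : D →ₗ[R] E) {T : Finset (ℕ →₀ R)} {d : D} (hd : d ∈ ppSet D T) : g d ∈ ppSet E T := by
  obtain ⟨h, rfl, hT⟩ := hd
  exact ⟨g ∘ₗ h, rfl, fun ρ hρ => by rw [LinearMap.comp_apply, hT ρ hρ, map_zero]⟩

open Classical in
/-- The relations of the first `n + 1` systems of a sequence, after making the variables other than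
`x₀` disjoint. -/
noncomputable def jointRelations (T : ℕ → Finset (ℕ →₀ R)) (n : ℕ) : Finset (ℕ →₀ R) :=
  (Finset.range (n + 1)).biUnion fun k => (T k).image (renameMap R k)

theorem mem_jointRelations {T : ℕ → Finset (ℕ →₀ R)} {n : ℕ} {ρ : ℕ →₀ R} :
    ρ ∈ jointRelations T n ↔ ∃ k ≤ n, ∃ σ ∈ T k, renameMap R k σ = ρ := by
  simp [jointRelations]

/-- The submodules generated by `jointRelations`. -/
noncomputable def jointRelationsSpan (T : ℕ → Finset (ℕ →₀ R)) (n : ℕ) : Submodule R (ℕ →₀ R) :=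
  Submodule.span R (jointRelations T n)

theorem jointRelationsSpan_mono (T : ℕ → Finset (ℕ →₀ R)) : Monotone (jointRelationsSpan T) := by
  refine fun n n' hn => Submodule.span_mono fun ρ hρ => ?_
  obtain ⟨k, hk, h⟩ := mem_jointRelations.1 hρ
  exact mem_jointRelations.2 ⟨k, hk.trans hn, h⟩

/-- The module presented by all relations of a sequence of finite systems. -/
abbrev JointModule (T : ℕ → Finset (ℕ →₀ R)) : Type u :=
  (ℕ →₀ R) ⧸ (⨆ n, jointRelationsSpan T n)

theorem isCountablyPresented_jointModule (T : ℕ → Finset (ℕ →₀ R)) :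
    IsCountablyPresented R (ULift.{w} (JointModule T)) := by
  -- The relation `0` is harmless and makes the set nonempty, so it can be listed by `ℕ` even if
  -- there are no other relations.
  have hcount : (insert 0 (⋃ n, (jointRelations T n : Set (ℕ →₀ R)))).Countable :=
    (Set.countable_iUnion fun n => (jointRelations T n).countable_toSet).insert 0
  obtain ⟨rel, hrel⟩ := hcount.exists_eq_range (Set.insert_nonempty _ _)
  refine ⟨Finsupp.linearCombination R rel,
    ULift.moduleEquiv.symm.toLinearMap ∘ₗ Submodule.mkQ _, ?_, ?_⟩
  · rw [LinearMap.exact_iff, LinearEquiv.ker_comp, Submodule.ker_mkQ,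
      Finsupp.range_linearCombination, ← hrel, Submodule.span_insert_zero, Submodule.span_iUnion]
    rfl
  · exact ULift.moduleEquiv.symm.surjective.comp (Submodule.mkQ_surjective _)

theorem mkQ_mem_ppSet_jointModule (T : ℕ → Finset (ℕ →₀ R)) (n : ℕ) :
    Submodule.mkQ _ (Finsupp.single 0 1) ∈ ppSet (JointModule T) (T n) := by
  refine ⟨Submodule.mkQ _ ∘ₗ renameMap R n, ?_, fun ρ hρ => ?_⟩
  · rw [LinearMap.comp_apply, renameMap_single_zero]
  · exact (Submodule.Quotient.mk_eq_zero _).2 (Submodule.mem_iSup_of_mem n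
      (Submodule.subset_span (mem_jointRelations.2 ⟨n, le_rfl, ρ, hρ, rfl⟩)))

theorem exists_linearMap_quotient_jointRelationsSpan {B : Type*} [AddCommGroup B] [Module R B]
    (T : ℕ → Finset (ℕ →₀ R)) (n : ℕ) {b : B} (hb : ∀ k ≤ n, b ∈ ppSet B (T k)) :
    ∃ h : (ℕ →₀ R) ⧸ jointRelationsSpan T n →ₗ[R] B,
      h (Submodule.mkQ _ (Finsupp.single 0 1)) = b := by
  have hex : ∀ k, ∃ h : (ℕ →₀ R) →ₗ[R] B, h (Finsupp.single 0 1) = b ∧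
      (k ≤ n → ∀ ρ ∈ T k, h ρ = 0) := fun k => by
    by_cases hk : k ≤ n
    · obtain ⟨h, h0, hT⟩ := hb k hk
      exact ⟨h, h0, fun _ => hT⟩
    -- For unused systems the default must still take the value `b` at `x₀`, or the solutions could
    -- not be glued.
    · exact ⟨Finsupp.linearCombination R fun _ => b, by simp, fun h => absurd h hk⟩
  choose h h0 hT using hex
  obtain ⟨H, hH⟩ := exists_comp_renameMap h b h0
  refine ⟨Submodule.liftQ _ H ?_, ?_⟩
  · rw [jointRelationsSpan, Submodule.span_le]
    intro ρ hρ
    obtain ⟨k, hk, σ, hσ, rfl⟩ := mem_jointRelations.1 hρ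
    exact (LinearMap.congr_fun (hH k) σ).trans (hT k hk σ hσ)
  · rw [Submodule.mkQ_apply, Submodule.liftQ_apply, ← h0 0, ← hH 0, LinearMap.comp_apply,
      renameMap_single_zero]

/-- The generic element comes from some `e` at stage `i`. At the Mittag-Leffler stage `j`, finite
presentation involves only the first formulas, up to some `n`, so each `b` satisfying formula `n` is
the value at `e` of a map from `F j`. Restricted to `F i`, that map factors through a later stage
where `e` satisfies formula `m`; hence so does `b`. -/
theorem exists_ppSet_subset_of_isStationaryModule {B : Type*} [AddCommGroup B] [Module R B]
    (T : ℕ → Finset (ℕ →₀ R)) (hanti : Antitone fun n => ppSet B (T n))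
    (hM : IsStationaryModule R B (ULift.{w} (JointModule T))) :
    ∃ n, ∀ m, ppSet B (T n) ⊆ ppSet B (T m) := by
  obtain ⟨P, hP⟩ := hM
  let v : JointModule T := Submodule.mkQ _ (Finsupp.single 0 1)
  obtain ⟨i, e, he⟩ := P.exists_toLimit_eq (ULift.up v)
  obtain ⟨j, hij, hj⟩ := hP i
  obtain ⟨n, ψ, hψ⟩ := Module.FinitePresentation.exists_lift_quotient_iSup
    (jointRelationsSpan T) (jointRelationsSpan_mono T)
    (ULift.moduleEquiv.toLinearMap ∘ₗ P.toLimit j) (P.f i j hij e) (Finsupp.single 0 1) (by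
      rw [LinearMap.comp_apply, P.compatible, he]
      rfl)
  refine ⟨n, fun m b hb => ?_⟩
  obtain ⟨h, hh⟩ := exists_linearMap_quotient_jointRelationsSpan T n fun k hk => hanti hk hb
  obtain ⟨k, hjk, hk⟩ := P.exists_ppSet (T := T m) (i := j) (e := P.f i j hij e) (by
    rw [P.compatible, he]
    exact map_mem_ppSet ULift.moduleEquiv.symm.toLinearMap (mkQ_mem_ppSet_jointModule T m))
  obtain ⟨z, hz⟩ : P.homMap B hij (h ∘ₗ ψ) ∈ Set.range (P.homMap B (hij.trans hjk)) :=
    hj k hjk ▸ Set.mem_range_self _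
  have hzb : z (P.f i k (hij.trans hjk) e) = b := by
    refine (LinearMap.congr_fun hz e).trans ?_
    change h (ψ (P.f i j hij e)) = b
    rw [hψ, hh]
  rw [← hzb, ← P.f_f hij hjk]
  exact map_mem_ppSet z hk

theorem hasPpDescendingChainCondition_of_isStationaryModule {B : Type*} [AddCommGroup B]
    [Module R B] (h : ∀ (M : Type (max u w)) [AddCommGroup M] [Module R M],
      IsCountablyPresented R M → IsStationaryModule R B M) :
    HasPpDescendingChainCondition R B := by
  refine wellFounded_iff_isEmpty_descending_chain.2 ⟨fun ⟨T, hT⟩ => ?_⟩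
  obtain ⟨n, hn⟩ := exists_ppSet_subset_of_isStationaryModule T
    (antitone_nat_of_succ_le fun n => (hT n).1)
    (h (ULift.{max u w} (JointModule T)) (isCountablyPresented_jointModule T))
  exact (hT n).2 (hn (n + 1))

end Stationary

theorem mainTheorem9 (R : Type u) [Ring R]
    (B : Type (max u w)) [AddCommGroup B] [Module R B] :
    List.TFAE [
      IsSigmaPureInjective R B,
      ∀ (M : Type (max u w)) [AddCommGroup M] [Module R M], IsStrictStationaryModule R B M,
      ∀ (M : Type (max u w)) [AddCommGroup M] [Module R M], IsStationaryModule R B M,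
      ∀ (M : Type (max u w)) [AddCommGroup M] [Module R M],
        IsCountablyPresented R M → IsStationaryModule R B M] := by
  tfae_have 1 → 2 := fun hB M _ _ => by
    obtain ⟨P⟩ := DirectedPresentation.nonempty_presentation.{u, w} R M
    exact ⟨P, P.isStrictMittagLeffler hB⟩
  tfae_have 2 → 3 := fun h M _ _ => by
    obtain ⟨P, hP⟩ := h M
    refine ⟨P, fun i => ?_⟩
    obtain ⟨j, hij, hj, -⟩ := hP i
    exact ⟨j, hij, hj⟩
  tfae_have 3 → 4 := fun h M _ _ _ => h M
  tfae_have 4 → 1 := fun h =>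
    (hasPpDescendingChainCondition_of_isStationaryModule.{u, w} h).isSigmaPureInjective
  tfae_finish
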